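/- Let $d\ge 1$. For a $d$-tuple $\boldsymbol\mu=(\mu_1,\dots,\mu_d)$ of finite nonzero Borel measures on $\mathbb R$ (for instance, probability measures) let $\bar\mu=\sum_j\mu_j\big/\sum_j\mu_j(\mathbb R)$, let $\boldsymbol\mu'=\left(\frac{d\mu_1}{d\bar\mu},\dots,\frac{d\mu_d}{d\bar\mu}\right):\mathbb R\to\mathbb R_+^d$ be the vector of Radon–Nikodym derivatives, and let $m_{\boldsymbol\mu}$ be the law of $\boldsymbol\mu'$ under $\bar\mu$. For a Borel probability measure $P$ on $\mathbb R^d$, let $\mathcal E_P$ be the set of all such $\boldsymbol\mu$ with $m_{\boldsymbol\mu}=P$. For $\boldsymbol\mu\in\mathcal E_P$, let $(\mu_{\mathbf z})_{\mathbf z}$ be a measurable family of probability measures on $\mathbb R$ (unique up to $P$-null sets of $\mathbf z$) that disintegrates $\bar\mu$ along $\boldsymbol\mu'$: $\mu_{\mathbf z}(\{x:\boldsymbol\mu'(x)\ne\mathbf z\})=0$ for $P$-a.e. $\mathbf z$, and $\int f\,d\bar\mu=\int\int f\,d\mu_{\mathbf z}\,P(d\mathbf z)$ for all Borel $f:\mathbb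 R\to[0,\infty]$. For two such tuples $\boldsymbol\mu,\boldsymbol\nu$ and a measurable cost $c:\mathbb R\times\mathbb R\to[0,\infty]$, let $$\mathcal I_c(\boldsymbol\mu,\boldsymbol\nu)=\inf_{\kappa}\int_{\mathbb R\times\mathbb R} c(x,y)\,\bar\mu(dx)\,\kappa(x;dy)\in[0,\infty],$$ where the infimum runs over all stochastic kernels $\kappa$ from $\mathbb R$ to $\mathbb R$ with $\int\kappa(x;B)\,\mu_j(dx)\ge\nu_j(B)$ for all Borel $B$ and all $j=1,\dots,d$ (and $\inf\emptyset=\infty$). **Corollary.** Let $\boldsymbol\mu,\boldsymbol\nu\in\mathcal E_P$, and let $c:\mathbb R\times\mathbb R\to[0,\infty]$ be continuous and submodular, i.e. $c(x,y)+c(x',y')\le c(x,y')+c(x',y)$ whenever $x\le x'$ and $y\le y'$. Then $$\mathcal I_c(\boldsymbol\mu,\boldsymbol\nu)=\int_{\mathbb R^d}\int_0^1 c\big(F_{\mathbf z}^{-1}(t),G_{\mathbf z}^{-1}(t)\big)\,dt\,P(d\mathbf z),$$ where $F_{\mathbf z}^{-1}(t)=\inf\{x:\mu_{\mathbf z}((-\infty,x])\ge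 t\}$ and $G_{\mathbf z}^{-1}(t)=\inf\{x:\nu_{\mathbf z}((-\infty,x])\ge t\}$, $t\in(0,1)$, are the quantile functions of the slice measures $\mu_{\mathbf z}$ and $\nu_{\mathbf z}$. -/

import Mathlib

open MeasureTheory ProbabilityTheory
open scoped ENNReal

namespace SOT

/-- The normalized average `(∑ⱼ μⱼ) / ∑ⱼ μⱼ(X)` of a tuple of measures. -/
noncomputable def avg {X : Type*} [MeasurableSpace X] {d : ℕ} (μ : Fin d → Measure X) :
    Measure X :=
  (∑ j, μ j Set.univ)⁻¹ • ∑ j, μ j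

/-- The vector of Radon-Nikodym derivatives `dμⱼ / dμ̄`, a function `X → ℝ^d`
with nonnegative components. -/
noncomputable def density {X : Type*} [MeasurableSpace X] {d : ℕ} (μ : Fin d → Measure X)
    (x : X) : Fin d → ℝ :=
  fun j => ((μ j).rnDeriv (avg μ) x).toReal

/-- The law on `ℝ^d` of the density vector under the average measure. -/
noncomputable def densityLaw {X : Type*} [MeasurableSpace X] {d : ℕ} (μ : Fin d → Measure X) :
    Measure (Fin d → ℝ) :=
  (avg μ).map (density μ)

/-- The class of all `d`-tuples of finite nonzero measures on `X` whose density law is `P`. -/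
def equivClass (X : Type*) [MeasurableSpace X] {d : ℕ} (P : Measure (Fin d → ℝ)) :
    Set (Fin d → Measure X) :=
  {μ | (∀ j, IsFiniteMeasure (μ j) ∧ μ j ≠ 0) ∧ densityLaw μ = P}

/-- Simultaneous transport kernels: the stochastic kernels `κ` with `κ_# μⱼ ≥ νⱼ` for all `j`. -/
def kernels {X Y : Type*} [MeasurableSpace X] [MeasurableSpace Y] {d : ℕ}
    (μ : Fin d → Measure X) (ν : Fin d → Measure Y) : Set (Kernel X Y) :=
  {κ | IsMarkovKernel κ ∧ ∀ j, ν j ≤ κ ∘ₘ μ j}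

/-- Simultaneous transport plans: the measures `μ̄ ⊗ κ` with `κ` a simultaneous transport
kernel. -/
def plans {X Y : Type*} [MeasurableSpace X] [MeasurableSpace Y] {d : ℕ}
    (μ : Fin d → Measure X) (ν : Fin d → Measure Y) : Set (Measure (X × Y)) :=
  {π | ∃ κ ∈ kernels μ ν, π = avg μ ⊗ₘ κ}

/-- The minimum (infimum) transport cost; it is `∞` if there is no transport plan. -/
noncomputable def minCost {X Y : Type*} [MeasurableSpace X] [MeasurableSpace Y] {d : ℕ}
    (c : X → Y → ℝ≥0∞) (μ : Fin d → Measure X) (ν : Fin d → Measure Y) : ℝ≥0∞ :=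
  ⨅ π ∈ plans μ ν, ∫⁻ p, c p.1 p.2 ∂π

/-- `μs` is a version of the family of slices `z ↦ μ_z` of `μ`: a measurable family of
probability measures disintegrating the average measure along the density vector. -/
structure IsSlicing {X : Type*} [MeasurableSpace X] {d : ℕ} (μ : Fin d → Measure X)
    (μs : Kernel (Fin d → ℝ) X) : Prop where
  isMarkov : IsMarkovKernel μs
  concentrated : ∀ᵐ z ∂(densityLaw μ), μs z {x | density μ x ≠ z} = 0
  disintegrate : ∀ f : X → ℝ≥0∞, Measurable f →
    ∫⁻ x, f x ∂(avg μ) = ∫⁻ z, ∫⁻ x, f x ∂(μs z) ∂(densityLaw μ)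

/-- Submodular functions on `ℝ × ℝ` with values in `[0, ∞]`. -/
def Submodular (c : ℝ → ℝ → ℝ≥0∞) : Prop :=
  ∀ x x' y y' : ℝ, x ≤ x' → y ≤ y' → c x y + c x' y' ≤ c x y' + c x' y

/-- The quantile function `t ↦ inf {x | F(x) ≥ t}` of a probability measure on `ℝ` with
distribution function `F`. -/
noncomputable def quantile (ρ : Measure ℝ) (t : ℝ) : ℝ :=
  sInf {x : ℝ | t ≤ cdf ρ x}

end SOT

/-! Since `μ` and `ν` have the same density law, the transport problem splits along the level sets
of the density vectors. The masses of `μ j` and `ν j` are both `∫ z_j dP`, so a simultaneous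
transport pushes `μ j` exactly onto `ν j`, and the averages onto each other. Under the resulting
plan, the mixed moment of the `j`-th densities at `x` and at `y` is `∫ (dν_j/dν̄) dν_j`, which is
the second moment of `z_j` under `P`, as are both second moments. So the mean square difference
vanishes: mass moves only between points of equal density vector (`ae_density_eq_of_mem_kernels`).

Conditioning the plan on `z` then gives couplings of the slices, and on each slice the comonotone
coupling is optimal (`Submodular.lintegral_quantile_le`). This gives the lower bound. Conversely,
gluing the comonotone couplings of the slices yields an admissible plan that attains the value
(`exists_mem_plans_lintegral_eq`).

Optimality on the line is reduced to finite lists: sample from the coupling, sort both coordinates,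
and pass to the limit with the strong law and Fatou's lemma. -/

namespace SOT
open Filter Topology

/-! ### Rearrangement inequality for finite lists -/

section Rearrangement

/-- The total cost of matching two lists entry by entry. -/
def listCost (c : ℝ → ℝ → ℝ≥0∞) (xs ys : List ℝ) : ℝ≥0∞ := (List.zipWith c xs ys).sum

lemma Submodular.swap {c : ℝ → ℝ → ℝ≥0∞} (hc : Submodular c) :
    Submodular (fun x y => c y x) := fun x x' y y' hx hy =>
  (hc y y' x x' hy hx).trans_eq (add_comm _ _)

lemma listCost_cons (c : ℝ → ℝ → ℝ≥0∞) (x y : ℝ) (xs ys : List ℝ) :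
    listCost c (x :: xs) (y :: ys) = c x y + listCost c xs ys := by simp [listCost]

lemma listCost_swap (c : ℝ → ℝ → ℝ≥0∞) (xs ys : List ℝ) :
    listCost (fun x y => c y x) xs ys = listCost c ys xs := by
  simp only [listCost]
  rw [List.zipWith_comm]

/-- Starting from the pairing of `y` with the head `x`, bubble `y` to its place: each exchange with
a smaller neighbour is one use of submodularity. Only the first list has to be sorted. -/
lemma Submodular.listCost_orderedInsert_right_le {c : ℝ → ℝ → ℝ≥0∞} (hc : Submodular c) (y : ℝ) :
    ∀ (x : ℝ) (xs ys : List ℝ), (x :: xs).Pairwise (· ≤ ·) → xs.length = ys.length →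
      listCost c (x :: xs) (ys.orderedInsert (· ≤ ·) y) ≤ c x y + listCost c xs ys
  | x, [], [], _, _ => by simp [listCost]
  | x, x' :: xs, y' :: ys, hs, hl => by
    by_cases h : y ≤ y'
    · simp [List.orderedInsert_cons_of_le _ _ h, listCost_cons]
    · rw [List.orderedInsert_of_not_le _ _ h, listCost_cons, listCost_cons]
      have hs' := List.pairwise_cons.1 hs
      have ih := hc.listCost_orderedInsert_right_le y x' xs ys hs'.2 (by simpa using hl)
      calc c x y' + listCost c (x' :: xs) (ys.orderedInsert (· ≤ ·) y)
          ≤ c x y' + (c x' y + listCost c xs ys) := by gcongr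
        _ = (c x y' + c x' y) + listCost c xs ys := by rw [add_assoc]
        _ ≤ (c x y + c x' y') + listCost c xs ys := by
            exact add_le_add_left (hc _ _ _ _ (hs'.1 x' (by simp)) (not_le.1 h).le) _
        _ = _ := by rw [add_assoc]

/-- As long as both new entries exceed the heads, the heads stay paired and can be stripped. Once
one new entry comes first, the one-sided lemma applies, up to swapping coordinates. -/
lemma Submodular.listCost_orderedInsert_le {c : ℝ → ℝ → ℝ≥0∞} (hc : Submodular c) (x y : ℝ) :
    ∀ (xs ys : List ℝ), xs.Pairwise (· ≤ ·) → ys.Pairwise (· ≤ ·) → xs.length = ys.length →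
      listCost c (xs.orderedInsert (· ≤ ·) x) (ys.orderedInsert (· ≤ ·) y)
        ≤ c x y + listCost c xs ys
  | [], [], _, _, _ => by simp [listCost]
  | x' :: xs, y' :: ys, hxs, hys, hl => by
    by_cases hx : x ≤ x'
    · rw [List.orderedInsert_cons_of_le _ _ hx]
      refine hc.listCost_orderedInsert_right_le y x (x' :: xs) (y' :: ys) ?_ hl
      exact List.pairwise_cons.2 ⟨fun a ha => hx.trans <| by
        rcases List.mem_cons.1 ha with rfl | ha
        · rfl
        · exact (List.pairwise_cons.1 hxs).1 a ha, hxs⟩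
    by_cases hy : y ≤ y'
    · rw [List.orderedInsert_cons_of_le _ _ hy, ← listCost_swap c, ← listCost_swap c]
      refine hc.swap.listCost_orderedInsert_right_le x y (y' :: ys) (x' :: xs) ?_ hl.symm
      exact List.pairwise_cons.2 ⟨fun a ha => hy.trans <| by
        rcases List.mem_cons.1 ha with rfl | ha
        · rfl
        · exact (List.pairwise_cons.1 hys).1 a ha, hys⟩
    rw [List.orderedInsert_of_not_le _ _ hx, List.orderedInsert_of_not_le _ _ hy,
      listCost_cons, listCost_cons]
    have ih := hc.listCost_orderedInsert_le x y xs ys (List.pairwise_cons.1 hxs).2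
      (List.pairwise_cons.1 hys).2 (by simpa using hl)
    calc _ ≤ c x' y' + (c x y + listCost c xs ys) := by gcongr
      _ = _ := by rw [add_left_comm]

/-- The rearrangement inequality for submodular costs. -/
lemma Submodular.listCost_insertionSort_le {c : ℝ → ℝ → ℝ≥0∞} (hc : Submodular c) :
    ∀ l : List (ℝ × ℝ), listCost c ((l.map Prod.fst).insertionSort (· ≤ ·))
      ((l.map Prod.snd).insertionSort (· ≤ ·)) ≤ (l.map fun p => c p.1 p.2).sum
  | [] => by simp [listCost]
  | p :: l => by
    simp only [List.map_cons, List.insertionSort_cons, List.sum_cons]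
    refine (hc.listCost_orderedInsert_le _ _ _ _ (List.pairwise_insertionSort _ _)
      (List.pairwise_insertionSort _ _) (by simp)).trans ?_
    gcongr
    exact hc.listCost_insertionSort_le l

lemma listCost_eq_sum_getD (c : ℝ → ℝ → ℝ≥0∞) :
    ∀ (n : ℕ) (xs ys : List ℝ), xs.length = n → ys.length = n →
      listCost c xs ys = ∑ i ∈ Finset.range n, c (xs.getD i 0) (ys.getD i 0)
  | 0, [], [], _, _ => by simp [listCost]
  | n + 1, x :: xs, y :: ys, hx, hy => by
    rw [listCost_cons, Finset.sum_range_succ', add_comm,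
      listCost_eq_sum_getD c n xs ys (by simpa using hx) (by simpa using hy)]
    simp

/-- This and the next lemma are the duality between order statistics and the empirical distribution
function. -/
lemma getD_le_of_lt_countP {L : List ℝ} (hL : L.Pairwise (· ≤ ·)) {q : ℝ} {k : ℕ}
    (h : k < L.countP (· ≤ q)) : L.getD k 0 ≤ q := by
  by_contra! hk
  have hkl : k < L.length := h.trans_le List.countP_le_length
  rw [List.getD_eq_getElem _ _ hkl] at hk
  rw [← List.take_append_drop k L, List.countP_append] at h
  have h0 : (L.drop k).countP (· ≤ q) = 0 := by
    rw [List.countP_eq_zero]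
    intro a ha
    obtain ⟨i, hi, rfl⟩ := List.getElem_of_mem ha
    simp only [List.getElem_drop, decide_eq_true_eq, not_le]
    refine hk.trans_le ?_
    exact hL.rel_get_of_le (a := ⟨k, hkl⟩) (b := ⟨k + i, by simp at hi; omega⟩) (by simp)
  have h1 : (L.take k).countP (· ≤ q) ≤ k := List.countP_le_length.trans (by simp)
  omega

lemma lt_getD_of_countP_le {L : List ℝ} (hL : L.Pairwise (· ≤ ·)) {q : ℝ} {k : ℕ}
    (hkl : k < L.length) (h : L.countP (· ≤ q) ≤ k) : q < L.getD k 0 := by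
  by_contra! hk
  rw [List.getD_eq_getElem _ _ hkl] at hk
  rw [← List.take_append_drop (k + 1) L, List.countP_append] at h
  have h0 : (L.take (k + 1)).countP (· ≤ q) = (L.take (k + 1)).length := by
    rw [List.countP_eq_length]
    intro a ha
    obtain ⟨i, hi, rfl⟩ := List.getElem_of_mem ha
    simp only [List.getElem_take, decide_eq_true_eq]
    refine le_trans ?_ hk
    simp at hi
    exact hL.rel_get_of_le (a := ⟨i, by omega⟩) (b := ⟨k, hkl⟩) (by simp; omega)
  rw [List.length_take] at h0
  omega

end Rearrangement

/-! ### Quantiles and distribution functions -/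

section Quantile

/-- Right continuity of the distribution function makes the infimum attained; `0 < t < 1` makes the
set bounded below and nonempty, so `sInf` takes no default value. -/
lemma quantile_le_iff {ρ : Measure ℝ} {t : ℝ} (ht : t ∈ Set.Ioo (0 : ℝ) 1) {x : ℝ} :
    quantile ρ t ≤ x ↔ t ≤ cdf ρ x := by
  obtain ⟨a, ha⟩ := ((tendsto_cdf_atBot ρ).eventually_lt_const ht.1).exists
  obtain ⟨b, hb⟩ := ((tendsto_cdf_atTop ρ).eventually_const_lt ht.2).exists
  have hbdd : BddBelow {x : ℝ | t ≤ cdf ρ x} := ⟨a, fun y hy => by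
    by_contra! h
    exact absurd (hy.trans (monotone_cdf ρ h.le)) (not_le.2 ha)⟩
  refine ⟨fun h => ?_, fun h => csInf_le hbdd h⟩
  by_contra! hlt
  have hr : ContinuousWithinAt (cdf ρ) (Set.Ioi x) x :=
    ((cdf ρ).right_continuous x).mono Set.Ioi_subset_Ici_self
  obtain ⟨y, hy, hxy⟩ := ((hr.eventually_lt_const hlt).and self_mem_nhdsWithin).exists
  have hxy' : x < y := hxy
  have : y ≤ quantile ρ t := le_csInf ⟨b, hb.le⟩ fun z hz => by
    by_contra! h
    exact absurd (le_trans hz (monotone_cdf ρ h.le)) (not_le.2 hy)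
  linarith

lemma lt_quantile_iff {ρ : Measure ℝ} {t : ℝ} (ht : t ∈ Set.Ioo (0 : ℝ) 1) {x : ℝ} :
    x < quantile ρ t ↔ cdf ρ x < t := by
  rw [← not_le, quantile_le_iff ht, not_le]

end Quantile

/-! ### Optimality of comonotone couplings by sampling -/

section Sampling

/-- The strong law on the infinite product holds almost surely for all countably many test functions
at once, so one good sample path can be fixed. -/
lemma exists_seq_tendsto_average {E ι : Type*} [MeasurableSpace E] [Countable ι] (π : Measure E)
    [IsProbabilityMeasure π] (f : ι → E → ℝ) (hfm : ∀ k, Measurable (f k))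
    (hf : ∀ k, Integrable (f k) π) {Q : E → Prop} (hQ : ∀ᵐ x ∂π, Q x) :
    ∃ p : ℕ → E, (∀ i, Q (p i)) ∧ ∀ k, Tendsto
      (fun n : ℕ => (∑ i ∈ Finset.range n, f k (p i)) / n) atTop (𝓝 (∫ x, f k x ∂π)) := by
  let μ := Measure.infinitePi (fun _ : ℕ => π)
  have hmp (i : ℕ) : MeasurePreserving (fun ω : ℕ → E => ω i) μ π :=
    measurePreserving_eval_infinitePi (fun _ : ℕ => π) i
  have h1 : ∀ᵐ ω ∂μ, ∀ i, Q (ω i) :=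
    ae_all_iff.2 fun i => (hmp i).quasiMeasurePreserving.ae hQ
  have h2 : ∀ᵐ ω ∂μ, ∀ k, Tendsto
      (fun n : ℕ => (∑ i ∈ Finset.range n, f k (ω i)) / n) atTop (𝓝 (∫ x, f k x ∂π)) := by
    refine ae_all_iff.2 fun k => ?_
    have key := strong_law_ae_real (μ := μ) (fun i ω => f k (ω i))
      ((hmp 0).integrable_comp_of_integrable (hf k))
      (fun i j hij => (iIndepFun_infinitePi (P := fun _ : ℕ => π) (X := fun _ => f k)
        (fun _ => hfm k)).indepFun hij)
      (fun i => ⟨((hfm k).comp (measurable_pi_apply i)).aemeasurable,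
        ((hfm k).comp (measurable_pi_apply 0)).aemeasurable, by
          have e (i : ℕ) : μ.map (fun ω => f k (ω i)) = π.map (f k) := by
            rw [← (hmp i).map_eq, Measure.map_map (hfm k) (measurable_pi_apply i)]
            rfl
          rw [e, e]⟩)
    have hint : ∫ ω, f k (ω 0) ∂μ = ∫ x, f k x ∂π := by
      rw [← (hmp 0).map_eq, integral_map (measurable_pi_apply 0).aemeasurable
        (hfm k).aestronglyMeasurable]
    rwa [hint] at key
  obtain ⟨ω, hω⟩ := (h1.and h2).exists
  exact ⟨ω, hω⟩

lemma lintegral_floor_le (h : ℕ → ℝ≥0∞) {n : ℕ} (hn : n ≠ 0) :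
    ∫⁻ t in Set.Ioo (0 : ℝ) 1, h ⌊n * t⌋₊ ≤ (∑ i ∈ Finset.range n, h i) / n := by
  have hn0 : (0 : ℝ) < n := by positivity
  have hsub : Set.Ioo (0 : ℝ) 1 ⊆
      ⋃ i : Fin n, Set.Ico ((i : ℝ) / n) (((i : ℝ) + 1) / n) := by
    intro t ht
    have hf : ⌊n * t⌋₊ < n := by
      rw [Nat.floor_lt (by nlinarith [ht.1])]
      nlinarith [ht.2]
    refine Set.mem_iUnion.2 ⟨⟨_, hf⟩, ?_, ?_⟩
    · rw [div_le_iff₀ hn0, mul_comm t]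
      exact Nat.floor_le (by nlinarith [ht.1])
    · rw [lt_div_iff₀ hn0, mul_comm t]
      exact Nat.lt_floor_add_one _
  calc ∫⁻ t in Set.Ioo (0 : ℝ) 1, h ⌊n * t⌋₊
      ≤ ∫⁻ t in ⋃ i : Fin n, Set.Ico ((i : ℝ) / n) (((i : ℝ) + 1) / n), h ⌊n * t⌋₊ :=
        lintegral_mono_set hsub
    _ ≤ ∑' i : Fin n, ∫⁻ t in Set.Ico ((i : ℝ) / n) (((i : ℝ) + 1) / n), h ⌊n * t⌋₊ :=
        lintegral_iUnion_le _ _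
    _ = ∑ i : Fin n, h i / n := by
        rw [tsum_fintype]
        refine Finset.sum_congr rfl fun i _ => ?_
        have : ∫⁻ t in Set.Ico ((i : ℝ) / n) (((i : ℝ) + 1) / n), h ⌊n * t⌋₊ =
            ∫⁻ _ in Set.Ico ((i : ℝ) / n) (((i : ℝ) + 1) / n), h i := by
          refine setLIntegral_congr_fun measurableSet_Ico fun t ht => ?_
          have h1 := (div_le_iff₀ hn0).1 ht.1
          have h2 := (lt_div_iff₀ hn0).1 ht.2
          have : ⌊n * t⌋₊ = i := by
            rw [Nat.floor_eq_iff (by nlinarith [(Nat.cast_nonneg (i : ℕ) : (0 : ℝ) ≤ (i : ℕ))])]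
            constructor <;> linarith
          simp only [this]
        rw [this, lintegral_const, Measure.restrict_apply_univ, Real.volume_Ico, ← sub_div,
          add_sub_cancel_left, ENNReal.ofReal_div_of_pos hn0, ENNReal.ofReal_one,
          ENNReal.ofReal_natCast, mul_one_div]
    _ = _ := by
        rw [Fin.sum_univ_eq_sum_range (fun i => h i / (n : ℝ≥0∞)) n]
        simp only [div_eq_mul_inv, Finset.sum_mul]

/-- The empirical quantiles of a sample converge to the quantiles of a law whose distribution
function is the limit of the empirical distribution functions. -/
lemma tendsto_empirical_quantile {ρ : Measure ℝ} {x : ℕ → ℝ}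
    (hx : ∀ q : ℚ, Tendsto (fun n : ℕ => (((List.range n).map x).countP (· ≤ (q : ℝ)) : ℝ) / n)
      atTop (𝓝 (cdf ρ q))) {t : ℝ} (ht : t ∈ Set.Ioo (0 : ℝ) 1) (htq : ∀ q : ℚ, cdf ρ q ≠ t) :
    Tendsto (fun n : ℕ => (((List.range n).map x).insertionSort (· ≤ ·)).getD ⌊n * t⌋₊ 0)
      atTop (𝓝 (quantile ρ t)) := by
  have hcount (n : ℕ) (q : ℝ) : (((List.range n).map x).insertionSort (· ≤ ·)).countP (· ≤ q)
      = ((List.range n).map x).countP (· ≤ q) :=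
    (List.perm_insertionSort _ _).countP_eq _
  refine tendsto_order.2 ⟨fun a ha => ?_, fun a ha => ?_⟩
  · obtain ⟨q, haq, hq⟩ := exists_rat_btwn ha
    filter_upwards [(hx q).eventually_lt_const ((lt_quantile_iff ht).1 hq), eventually_gt_atTop 0]
      with n hn hn0
    have hn0' : (0 : ℝ) < n := by exact_mod_cast hn0
    refine haq.trans (lt_getD_of_countP_le (List.pairwise_insertionSort _ _) ?_ ?_)
    · rw [List.length_insertionSort, List.length_map, List.length_range,
        Nat.floor_lt (by nlinarith [ht.1])]
      nlinarith [ht.2]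
    · rw [hcount]
      refine Nat.le_floor ?_
      rw [div_lt_iff₀ hn0'] at hn
      linarith
  · obtain ⟨q, hq, haq⟩ := exists_rat_btwn ha
    -- Duality gives only `≤`; excluding the countably many values `cdf ρ q` makes it strict.
    have hq' : t < cdf ρ q := lt_of_le_of_ne ((quantile_le_iff ht).1 hq.le) (htq q).symm
    filter_upwards [(hx q).eventually_const_lt hq', eventually_gt_atTop 0] with n hn hn0
    have hn0' : (0 : ℝ) < n := by exact_mod_cast hn0
    refine lt_of_le_of_lt (getD_le_of_lt_countP (List.pairwise_insertionSort _ _) ?_) haq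
    rw [hcount, Nat.floor_lt (by nlinarith [ht.1])]
    rw [lt_div_iff₀ hn0'] at hn
    linarith

lemma countP_map_range (x : ℕ → ℝ) (q : ℝ) (n : ℕ) :
    (((List.range n).map x).countP (· ≤ q) : ℝ) =
      ∑ i ∈ Finset.range n, (Set.Iic q).indicator 1 (x i) := by
  induction n with
  | zero => simp
  | succ n ih =>
    rw [List.range_succ, List.map_append, List.countP_append, Nat.cast_add, ih,
      Finset.sum_range_succ]
    by_cases h : x n ≤ q <;> simp [h]

/-- Comonotone couplings are optimal for submodular costs. -/
theorem Submodular.lintegral_quantile_le {c : ℝ → ℝ → ℝ≥0∞} (hsub : Submodular c)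
    (hc : Continuous (fun p : ℝ × ℝ => c p.1 p.2)) (π : Measure (ℝ × ℝ))
    [IsProbabilityMeasure π] :
    ∫⁻ t in Set.Ioo (0 : ℝ) 1, c (quantile π.fst t) (quantile π.snd t)
      ≤ ∫⁻ p, c p.1 p.2 ∂π := by
  by_cases htop : ∫⁻ p, c p.1 p.2 ∂π = ∞
  · simp [htop]
  -- Test functions: the cost, and the indicators giving both marginal distribution functions at
  -- rational points.
  let f : Option (ℚ ⊕ ℚ) → ℝ × ℝ → ℝ
    | none => fun p => (c p.1 p.2).toReal
    | some (.inl q) => fun p => (Set.Iic (q : ℝ)).indicator 1 p.1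
    | some (.inr q) => fun p => (Set.Iic (q : ℝ)).indicator 1 p.2
  have hind (q : ℝ) : Measurable ((Set.Iic q).indicator (1 : ℝ → ℝ)) :=
    measurable_one.indicator measurableSet_Iic
  have hfm : ∀ k, Measurable (f k)
    | none => hc.measurable.ennreal_toReal
    | some (.inl q) => (hind q).comp measurable_fst
    | some (.inr q) => (hind q).comp measurable_snd
  have hbd (g : ℝ × ℝ → ℝ) (hg : Measurable g) (q : ℝ) :
      Integrable (fun p => (Set.Iic q).indicator (1 : ℝ → ℝ) (g p)) π := by
    refine Integrable.of_bound ((hind q).comp hg).aestronglyMeasurable 1 (ae_of_all _ fun p => ?_)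
    by_cases h : g p ≤ q <;> simp [h]
  have hfi : ∀ k, Integrable (f k) π
    | none => integrable_toReal_of_lintegral_ne_top hc.measurable.aemeasurable htop
    | some (.inl q) => hbd _ measurable_fst q
    | some (.inr q) => hbd _ measurable_snd q
  have hfin : ∀ᵐ p ∂π, c p.1 p.2 < ∞ := ae_lt_top hc.measurable htop
  obtain ⟨p, hpfin, hp⟩ := exists_seq_tendsto_average π f hfm hfi hfin
  have hmarg (g : ℝ × ℝ → ℝ) (hg : Measurable g) (q : ℝ) :
      ∫ p, (Set.Iic q).indicator (1 : ℝ → ℝ) (g p) ∂π = cdf (π.map g) q := by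
    have := Measure.isProbabilityMeasure_map (μ := π) hg.aemeasurable
    rw [← integral_map hg.aemeasurable (hind q).aestronglyMeasurable,
      integral_indicator_one measurableSet_Iic, cdf_eq_real]
  have hx (q : ℚ) : Tendsto (fun n : ℕ =>
      (((List.range n).map fun i => (p i).1).countP (· ≤ (q : ℝ)) : ℝ) / n)
      atTop (𝓝 (cdf π.fst q)) := by
    have := hp (some (.inl q))
    simp only [f] at this
    rw [hmarg _ measurable_fst] at this
    simpa only [countP_map_range, Measure.fst, Measure.snd] using this
  have hy (q : ℚ) : Tendsto (fun n : ℕ =>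
      (((List.range n).map fun i => (p i).2).countP (· ≤ (q : ℝ)) : ℝ) / n)
      atTop (𝓝 (cdf π.snd q)) := by
    have := hp (some (.inr q))
    simp only [f] at this
    rw [hmarg _ measurable_snd] at this
    simpa only [countP_map_range, Measure.fst, Measure.snd] using this
  let xs (n : ℕ) : List ℝ := ((List.range n).map fun i => (p i).1).insertionSort (· ≤ ·)
  let ys (n : ℕ) : List ℝ := ((List.range n).map fun i => (p i).2).insertionSort (· ≤ ·)
  let h (n : ℕ) (i : ℕ) : ℝ≥0∞ := c ((xs n).getD i 0) ((ys n).getD i 0)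
  have hlim : ∀ᵐ t ∂(volume.restrict (Set.Ioo (0 : ℝ) 1)),
      c (quantile π.fst t) (quantile π.snd t) = liminf (fun n : ℕ => h n ⌊n * t⌋₊) atTop := by
    have hcount : (Set.range (fun q : ℚ => cdf π.fst q) ∪
        Set.range fun q : ℚ => cdf π.snd q).Countable :=
      (Set.countable_range _).union (Set.countable_range _)
    filter_upwards [ae_restrict_mem measurableSet_Ioo,
      ae_restrict_of_ae (hcount.ae_notMem volume)] with t ht hnt
    have h1 := tendsto_empirical_quantile hx ht fun q hq => hnt (.inl ⟨q, hq⟩)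
    have h2 := tendsto_empirical_quantile hy ht fun q hq => hnt (.inr ⟨q, hq⟩)
    exact ((hc.tendsto _).comp (h1.prodMk_nhds h2)).liminf_eq.symm
  have hsum (n : ℕ) : ∑ i ∈ Finset.range n, h n i ≤ ∑ i ∈ Finset.range n, c (p i).1 (p i).2 := by
    rw [← listCost_eq_sum_getD c n (xs n) (ys n) (by simp [xs]) (by simp [ys])]
    have := hsub.listCost_insertionSort_le ((List.range n).map p)
    simp only [List.map_map] at this
    refine this.trans_eq ?_
    rw [Finset.sum_eq_multiset_sum, Finset.range_val, Multiset.range, Multiset.map_coe,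
      Multiset.sum_coe]
    rfl
  have hmean : Tendsto (fun n : ℕ => (∑ i ∈ Finset.range n, c (p i).1 (p i).2) / (n : ℝ≥0∞))
      atTop (𝓝 (∫⁻ p, c p.1 p.2 ∂π)) := by
    have h0 := ENNReal.tendsto_ofReal (hp none)
    rw [show f none = fun p => (c p.1 p.2).toReal from rfl,
      integral_toReal hc.measurable.aemeasurable hfin, ENNReal.ofReal_toReal htop] at h0
    refine h0.congr' ?_
    filter_upwards [eventually_gt_atTop 0] with n hn
    rw [ENNReal.ofReal_div_of_pos (by exact_mod_cast hn), ENNReal.ofReal_natCast,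
      ENNReal.ofReal_sum_of_nonneg fun _ _ => ENNReal.toReal_nonneg]
    congr 1
    exact Finset.sum_congr rfl fun i _ => ENNReal.ofReal_toReal (hpfin i).ne
  calc ∫⁻ t in Set.Ioo (0 : ℝ) 1, c (quantile π.fst t) (quantile π.snd t)
      = ∫⁻ t in Set.Ioo (0 : ℝ) 1, liminf (fun n : ℕ => h n ⌊n * t⌋₊) atTop :=
        lintegral_congr_ae hlim
    -- Fatou's lemma: continuity of the cost suffices, with no bound on it.
    _ ≤ liminf (fun n : ℕ => ∫⁻ t in Set.Ioo (0 : ℝ) 1, h n ⌊n * t⌋₊) atTop :=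
        lintegral_liminf_le fun n =>
          (measurable_from_nat (f := h n)).comp (Nat.measurable_floor.comp (by fun_prop))
    _ ≤ liminf (fun n : ℕ => (∑ i ∈ Finset.range n, c (p i).1 (p i).2) / (n : ℝ≥0∞)) atTop := by
        refine liminf_le_liminf ?_
        filter_upwards [eventually_ne_atTop 0] with n hn
        refine (lintegral_floor_le (h n) hn).trans ?_
        exact ENNReal.div_le_div_right (hsum n) _
    _ = ∫⁻ p, c p.1 p.2 ∂π := hmean.liminf_eq

end Sampling

/-! ### Simultaneous transports preserve the density vector -/

section Density

variable {X Y : Type*} [MeasurableSpace X] [MeasurableSpace Y] {d : ℕ} {P : Measure (Fin d → ℝ)}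
  {μ : Fin d → Measure X} {ν : Fin d → Measure Y}

@[fun_prop]
lemma measurable_density (μ : Fin d → Measure X) : Measurable (density μ) :=
  measurable_pi_lambda _ fun _ => (Measure.measurable_rnDeriv _ _).ennreal_toReal

lemma density_nonneg (μ : Fin d → Measure X) (x : X) (j : Fin d) : 0 ≤ density μ x j :=
  ENNReal.toReal_nonneg

/-- The mass is read off from `P`; this also rules out `d = 0`, where the average is zero. -/
lemma isProbabilityMeasure_avg [IsProbabilityMeasure P] (hμ : μ ∈ equivClass X P) :
    IsProbabilityMeasure (avg μ) := by
  refine ⟨?_⟩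
  have h : densityLaw μ Set.univ = 1 := by rw [hμ.2, measure_univ]
  rwa [densityLaw, Measure.map_apply (measurable_density μ) MeasurableSet.univ,
    Set.preimage_univ] at h

lemma sum_measure_univ_ne_top (hμ : μ ∈ equivClass X P) : ∑ j, μ j Set.univ ≠ ∞ :=
  (ENNReal.sum_lt_top.2 fun j _ => (hμ.1 j).1.measure_univ_lt_top).ne

lemma le_smul_avg (hμ : μ ∈ equivClass X P) (j : Fin d) :
    μ j ≤ (∑ j, μ j Set.univ) • avg μ := by
  have h0 : ∑ j, μ j Set.univ ≠ 0 := fun h =>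
    (hμ.1 j).2 (Measure.measure_univ_eq_zero.1 (Finset.sum_eq_zero_iff.1 h j (Finset.mem_univ j)))
  rw [avg, smul_smul, ENNReal.mul_inv_cancel h0 (sum_measure_univ_ne_top hμ), one_smul]
  exact Finset.single_le_sum (f := μ) (fun _ _ => Measure.zero_le _) (Finset.mem_univ j)

variable [IsProbabilityMeasure P]

/-- The components of the density vector are densities with respect to the average measure. -/
lemma lintegral_density_mul (hμ : μ ∈ equivClass X P) (j : Fin d) {g : X → ℝ≥0∞}
    (hg : Measurable g) :
    ∫⁻ x, ENNReal.ofReal (density μ x j) * g x ∂(avg μ) = ∫⁻ x, g x ∂(μ j) := by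
  have := isProbabilityMeasure_avg hμ
  have := (hμ.1 j).1
  have hac : μ j ≪ avg μ :=
    (Measure.absolutelyContinuous_of_le (le_smul_avg hμ j)).trans
      (Measure.smul_absolutelyContinuous)
  rw [← lintegral_rnDeriv_mul hac hg.aemeasurable]
  refine lintegral_congr_ae ?_
  filter_upwards [Measure.rnDeriv_lt_top (μ j) (avg μ)] with x hx
  rw [density, ENNReal.ofReal_toReal hx.ne]

omit [IsProbabilityMeasure P] in
lemma lintegral_density_comp (hμ : μ ∈ equivClass X P) {g : (Fin d → ℝ) → ℝ≥0∞}
    (hg : Measurable g) : ∫⁻ x, g (density μ x) ∂(avg μ) = ∫⁻ z, g z ∂P := by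
  rw [← hμ.2, densityLaw, lintegral_map hg (measurable_density μ)]

lemma measurable_ofReal_density (μ : Fin d → Measure X) (j : Fin d) :
    Measurable fun x => ENNReal.ofReal (density μ x j) :=
  ((measurable_pi_apply j).comp (measurable_density μ)).ennreal_ofReal

lemma measure_univ_eq_lintegral (hμ : μ ∈ equivClass X P) (j : Fin d) :
    μ j Set.univ = ∫⁻ z, ENNReal.ofReal (z j) ∂P := by
  rw [← lintegral_density_comp hμ (g := fun z => ENNReal.ofReal (z j)) (by fun_prop),
    ← lintegral_one, ← lintegral_density_mul hμ j measurable_const]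
  simp

/-- The second moment is `∫ (dμ_j/dμ̄) dμ_j`, and `μ j` is at most a constant times the average. -/
lemma lintegral_sq_ne_top (hμ : μ ∈ equivClass X P) (j : Fin d) :
    ∫⁻ z, ENNReal.ofReal (z j) ^ 2 ∂P ≠ ∞ := by
  have := (hμ.1 j).1
  rw [← lintegral_density_comp hμ (g := fun z => ENNReal.ofReal (z j) ^ 2) (by fun_prop)]
  simp only [sq]
  rw [lintegral_density_mul hμ j (measurable_ofReal_density μ j)]
  refine ((lintegral_mono' (le_smul_avg hμ j) le_rfl).trans_lt ?_).ne
  rw [lintegral_smul_measure,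
    lintegral_density_comp hμ (g := fun z => ENNReal.ofReal (z j)) (by fun_prop),
    ← measure_univ_eq_lintegral hμ j]
  exact ENNReal.mul_lt_top (sum_measure_univ_ne_top hμ).lt_top (measure_lt_top _ _)

lemma lintegral_compProd_density_mul (hμ : μ ∈ equivClass X P) (κ : Kernel X Y) [IsMarkovKernel κ]
    (j : Fin d) {g : Y → ℝ≥0∞} (hg : Measurable g) :
    ∫⁻ p, ENNReal.ofReal (density μ p.1 j) * g p.2 ∂(avg μ ⊗ₘ κ) = ∫⁻ y, g y ∂(κ ∘ₘ μ j) := by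
  have := isProbabilityMeasure_avg hμ
  rw [Measure.lintegral_compProd (by fun_prop), Measure.lintegral_bind κ.aemeasurable hg.aemeasurable,
    ← lintegral_density_mul hμ j hg.lintegral_kernel]
  exact lintegral_congr fun x => lintegral_const_mul (ENNReal.ofReal (density μ x j)) hg

/-- A simultaneous transport kernel between tuples with equal density laws pushes each measure
exactly onto its target. -/
lemma comp_eq_of_mem_kernels (hμ : μ ∈ equivClass X P) (hν : ν ∈ equivClass Y P)
    {κ : Kernel X Y} (hκ : κ ∈ kernels μ ν) (j : Fin d) : κ ∘ₘ μ j = ν j := by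
  have := hκ.1
  have := (hμ.1 j).1
  have := (hν.1 j).1
  refine (Measure.eq_of_le_of_measure_univ_eq (hκ.2 j) ?_).symm
  rw [measure_univ_eq_lintegral hν, Measure.bind_apply MeasurableSet.univ κ.aemeasurable]
  simp [measure_univ_eq_lintegral hμ]

lemma comp_avg_eq_of_mem_kernels (hμ : μ ∈ equivClass X P) (hν : ν ∈ equivClass Y P)
    {κ : Kernel X Y} (hκ : κ ∈ kernels μ ν) : κ ∘ₘ avg μ = avg ν := by
  ext s hs
  rw [Measure.bind_apply hs κ.aemeasurable, avg, avg, lintegral_smul_measure,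
    lintegral_finsetSum_measure]
  simp only [measure_univ_eq_lintegral hμ, measure_univ_eq_lintegral hν,
    Measure.smul_apply, Measure.finsetSum_apply]
  congr 1
  refine Finset.sum_congr rfl fun j _ => ?_
  rw [← comp_eq_of_mem_kernels hμ hν hκ j, Measure.bind_apply hs κ.aemeasurable]

/-- Expand `∫ (a - b)² = 0`. The identity is kept additive in `ℝ≥0∞`; finiteness allows the
cancellation. -/
lemma ae_eq_of_lintegral_mul_eq {Ω : Type*} [MeasurableSpace Ω] {π : Measure Ω} {a b : Ω → ℝ}
    (ha : Measurable a) (hb : Measurable b) (ha0 : ∀ ω, 0 ≤ a ω) (hb0 : ∀ ω, 0 ≤ b ω)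
    (hab : ∫⁻ ω, ENNReal.ofReal (a ω) * ENNReal.ofReal (b ω) ∂π =
      ∫⁻ ω, ENNReal.ofReal (b ω) ^ 2 ∂π)
    (haa : ∫⁻ ω, ENNReal.ofReal (a ω) ^ 2 ∂π = ∫⁻ ω, ENNReal.ofReal (b ω) ^ 2 ∂π)
    (htop : ∫⁻ ω, ENNReal.ofReal (b ω) ^ 2 ∂π ≠ ∞) : a =ᵐ[π] b := by
  have hpt (ω : Ω) : ENNReal.ofReal (a ω) * ENNReal.ofReal (b ω) +
      ENNReal.ofReal (a ω) * ENNReal.ofReal (b ω) + ENNReal.ofReal ((a ω - b ω) ^ 2) =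
      ENNReal.ofReal (a ω) ^ 2 + ENNReal.ofReal (b ω) ^ 2 := by
    have := mul_nonneg (ha0 ω) (hb0 ω)
    rw [← ENNReal.ofReal_mul (ha0 ω), ← ENNReal.ofReal_pow (ha0 ω), ← ENNReal.ofReal_pow (hb0 ω),
      ← ENNReal.ofReal_add this this, ← ENNReal.ofReal_add (by positivity) (by positivity),
      ← ENNReal.ofReal_add (by positivity) (by positivity)]
    congr 1
    ring
  have hint := lintegral_congr (μ := π) hpt
  have hm : Measurable fun ω => ENNReal.ofReal (a ω) * ENNReal.ofReal (b ω) := by fun_prop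
  rw [lintegral_add_right _ (by fun_prop), lintegral_add_left hm, lintegral_add_right _ (by fun_prop),
    hab, haa] at hint
  have h0 : ∫⁻ ω, ENNReal.ofReal ((a ω - b ω) ^ 2) ∂π = 0 := by
    have h2 := ENNReal.add_ne_top.2 ⟨htop, htop⟩
    exact (ENNReal.add_right_inj h2).1 (hint.trans (add_zero _).symm)
  rw [lintegral_eq_zero_iff (by fun_prop)] at h0
  filter_upwards [h0] with ω hω
  have h1 : (a ω - b ω) ^ 2 ≤ 0 := ENNReal.ofReal_eq_zero.1 hω
  have h3 := pow_eq_zero_iff two_ne_zero |>.1 (le_antisymm h1 (sq_nonneg _))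
  linarith

/-- A simultaneous transport between tuples with equal density laws preserves the density
vector. -/
lemma ae_density_eq_of_mem_kernels (hμ : μ ∈ equivClass X P) (hν : ν ∈ equivClass Y P)
    {κ : Kernel X Y} (hκ : κ ∈ kernels μ ν) :
    ∀ᵐ p ∂(avg μ ⊗ₘ κ), density μ p.1 = density ν p.2 := by
  have := hκ.1
  have := isProbabilityMeasure_avg hμ
  have hsnd : (avg μ ⊗ₘ κ).map Prod.snd = avg ν :=
    (Measure.snd_compProd _ _).trans (comp_avg_eq_of_mem_kernels hμ hν hκ)
  have hfst : (avg μ ⊗ₘ κ).map Prod.fst = avg μ := Measure.fst_compProd _ _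
  have hmb := measurable_ofReal_density ν
  have hma := measurable_ofReal_density μ
  have hall (j : Fin d) : (fun p : X × Y => density μ p.1 j) =ᵐ[avg μ ⊗ₘ κ]
      fun p => density ν p.2 j := by
    have hbb : ∫⁻ p, ENNReal.ofReal (density ν p.2 j) ^ 2 ∂(avg μ ⊗ₘ κ) =
        ∫⁻ z, ENNReal.ofReal (z j) ^ 2 ∂P := by
      rw [← lintegral_density_comp hν (g := fun z => ENNReal.ofReal (z j) ^ 2) (by fun_prop),
        ← hsnd, lintegral_map ((hmb j).pow_const 2) measurable_snd]
    have haa : ∫⁻ p, ENNReal.ofReal (density μ p.1 j) ^ 2 ∂(avg μ ⊗ₘ κ) =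
        ∫⁻ z, ENNReal.ofReal (z j) ^ 2 ∂P := by
      rw [← lintegral_density_comp hμ (g := fun z => ENNReal.ofReal (z j) ^ 2) (by fun_prop)]
      conv_rhs => rw [← hfst]
      rw [lintegral_map ((hma j).pow_const 2) measurable_fst]
    refine ae_eq_of_lintegral_mul_eq
      ((measurable_pi_apply j).comp ((measurable_density μ).comp measurable_fst))
      ((measurable_pi_apply j).comp ((measurable_density ν).comp measurable_snd))
      (fun p => density_nonneg μ _ j) (fun p => density_nonneg ν _ j) ?_ (haa.trans hbb.symm)
      (hbb ▸ lintegral_sq_ne_top hν j)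
    -- Mixed moment: weighting the plan by the density of `μ j` gives second marginal `ν j`.
    have h1 := lintegral_compProd_density_mul hμ κ j (hmb j)
    rw [comp_eq_of_mem_kernels hμ hν hκ j, ← lintegral_density_mul hν j (hmb j), ← hsnd,
      lintegral_map (by fun_prop) measurable_snd] at h1
    simpa only [sq] using h1
  filter_upwards [ae_all_iff.2 hall] with p hp
  exact funext hp

/-- Recasts a slicing as a disintegration of the joint law of density vector and point, so that a.e.
uniqueness of disintegrations applies. -/
lemma IsSlicing.compProd_eq (hμ : μ ∈ equivClass X P) {μs : Kernel (Fin d → ℝ) X}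
    (h : IsSlicing μ μs) : P ⊗ₘ μs = (avg μ).map fun x => (density μ x, x) := by
  have := h.isMarkov
  have hm : Measurable fun x => (density μ x, x) := (measurable_density μ).prodMk measurable_id
  have hdis := h.disintegrate
  have hcon := h.concentrated
  rw [hμ.2] at hdis hcon
  ext s hs
  rw [Measure.map_apply hm hs, Measure.compProd_apply hs, ← lintegral_indicator_one (hm hs),
    hdis _ (measurable_one.indicator (hm hs))]
  refine lintegral_congr_ae ?_
  filter_upwards [hcon] with z hz
  rw [lintegral_indicator_one (hm hs)]
  refine measure_congr ?_
  filter_upwards [show ∀ᵐ x ∂(μs z), density μ x = z from hz] with x hx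
  show ((z, x) ∈ s) = ((density μ x, x) ∈ s)
  rw [hx]

end Density

/-! ### Measurable quantile transform of a kernel -/

section QuantileKernel

variable {α : Type*} [MeasurableSpace α]

open Classical in
/-- The quantile functions of a kernel, as a function of the parameter and the level; set to `0`
outside of the levels in `(0, 1)`. -/
noncomputable def kernelQuantile (k : Kernel α ℝ) (w : α × ℝ) : ℝ :=
  if w.2 ∈ Set.Ioo (0 : ℝ) 1 then quantile (k w.1) w.2 else 0

lemma kernelQuantile_of_mem (k : Kernel α ℝ) {z : α} {t : ℝ} (ht : t ∈ Set.Ioo (0 : ℝ) 1) :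
    kernelQuantile k (z, t) = quantile (k z) t := if_pos ht

lemma measurable_kernelQuantile (k : Kernel α ℝ) [IsMarkovKernel k] :
    Measurable (kernelQuantile k) := by
  refine measurable_of_Iic fun x => ?_
  have hI : MeasurableSet {w : α × ℝ | w.2 ∈ Set.Ioo (0 : ℝ) 1} :=
    measurable_snd measurableSet_Ioo
  have hF : Measurable fun w : α × ℝ => cdf (k w.1) x := by
    simp only [cdf_eq_real]
    exact ((k.measurable_coe measurableSet_Iic).comp measurable_fst).ennreal_toReal
  have : kernelQuantile k ⁻¹' Set.Iic x =
      ({w | w.2 ∈ Set.Ioo (0 : ℝ) 1} ∩ {w | w.2 ≤ cdf (k w.1) x}) ∪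
      ({w | w.2 ∈ Set.Ioo (0 : ℝ) 1}ᶜ ∩ {_w | 0 ≤ x}) := by
    ext w
    by_cases hw : w.2 ∈ Set.Ioo (0 : ℝ) 1
    · have hw' := hw
      simp only [Set.mem_Ioo] at hw'
      simp [kernelQuantile, hw', quantile_le_iff hw]
    · have hw' := hw
      simp only [Set.mem_Ioo] at hw'
      simp [kernelQuantile, hw']
  rw [this]
  exact (hI.inter (measurableSet_le measurable_snd hF)).union (hI.compl.inter (.const _))

lemma volume_Ioo_inter_Iic {a : ℝ} (ha1 : a ≤ 1) :
    volume (Set.Iic a ∩ Set.Ioo (0 : ℝ) 1) = ENNReal.ofReal a := by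
  refine le_antisymm ?_ ?_
  · refine (measure_mono (t := Set.Ioc 0 a) fun t ht => ⟨ht.2.1, ht.1⟩).trans_eq ?_
    simp
  · refine Eq.trans_le ?_ (measure_mono (s := Set.Ioo 0 a)
      fun t ht => ⟨ht.2.le, ht.1, ht.2.trans_le ha1⟩)
    simp

lemma map_kernelQuantile (k : Kernel α ℝ) [IsMarkovKernel k] (z : α) :
    (volume.restrict (Set.Ioo (0 : ℝ) 1)).map (fun t => kernelQuantile k (z, t)) = k z := by
  have hm : Measurable fun t => kernelQuantile k (z, t) :=
    (measurable_kernelQuantile k).comp measurable_prodMk_left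
  have : IsFiniteMeasure (volume.restrict (Set.Ioo (0 : ℝ) 1)) := ⟨by simp⟩
  refine Measure.ext_of_Iic _ _ fun x => ?_
  rw [Measure.map_apply hm measurableSet_Iic, Measure.restrict_apply (hm measurableSet_Iic),
    ← ofReal_cdf, ← volume_Ioo_inter_Iic (cdf_le_one _ x)]
  congr 1
  ext t
  simp only [Set.mem_inter_iff, Set.mem_preimage, Set.mem_Iic]
  refine and_congr_left fun ht => ?_
  rw [kernelQuantile_of_mem k ht, quantile_le_iff ht]

lemma map_prod_kernelQuantile (P : Measure α) [SFinite P] (k : Kernel α ℝ) [IsMarkovKernel k] :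
    (P.prod (volume.restrict (Set.Ioo (0 : ℝ) 1))).map (fun w => (w.1, kernelQuantile k w)) =
      P ⊗ₘ k := by
  have hm := measurable_fst.prodMk (measurable_kernelQuantile k)
  ext s hs
  rw [Measure.map_apply hm hs, Measure.prod_apply (hm hs), Measure.compProd_apply hs]
  refine lintegral_congr fun z => ?_
  have hq : Measurable fun t => kernelQuantile k (z, t) :=
    (measurable_kernelQuantile k).comp measurable_prodMk_left
  rw [← map_kernelQuantile k z, Measure.map_apply hq (measurable_prodMk_left hs)]
  rfl

end QuantileKernel

/-! ### Lower bound by conditioning, upper bound by gluing -/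

section Cost

variable {d : ℕ} {P : Measure (Fin d → ℝ)} [IsProbabilityMeasure P] {μ ν : Fin d → Measure ℝ}
  {μs νs : Kernel (Fin d → ℝ) ℝ} {c : ℝ → ℝ → ℝ≥0∞}

lemma le_lintegral_of_mem_kernels (hμ : μ ∈ equivClass ℝ P) (hν : ν ∈ equivClass ℝ P)
    (hμs : IsSlicing μ μs) (hνs : IsSlicing ν νs)
    (hc : Continuous (fun p : ℝ × ℝ => c p.1 p.2)) (hsub : Submodular c)
    {κ : Kernel ℝ ℝ} (hκ : κ ∈ kernels μ ν) :
    ∫⁻ z, (∫⁻ t in Set.Ioo (0 : ℝ) 1, c (quantile (μs z) t) (quantile (νs z) t)) ∂P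
      ≤ ∫⁻ p, c p.1 p.2 ∂(avg μ ⊗ₘ κ) := by
  have := hκ.1
  have := isProbabilityMeasure_avg hμ
  have := hμs.isMarkov
  have := hνs.isMarkov
  set π := avg μ ⊗ₘ κ
  have hfst : π.map Prod.fst = avg μ := Measure.fst_compProd _ _
  have hsnd : π.map Prod.snd = avg ν :=
    (Measure.snd_compProd _ _).trans (comp_avg_eq_of_mem_kernels hμ hν hκ)
  have hdm := measurable_density μ
  have hdn := measurable_density ν
  have hm : Measurable fun p : ℝ × ℝ => (density μ p.1, p) :=
    (hdm.comp measurable_fst).prodMk measurable_id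
  -- Conditioning `ρ` on its first coordinate splits the plan into couplings of slices.
  let ρ := π.map fun p => (density μ p.1, p)
  have : IsProbabilityMeasure ρ := Measure.isProbabilityMeasure_map hm.aemeasurable
  have hρfst : ρ.fst = P := by
    rw [Measure.fst, Measure.map_map measurable_fst hm, ← hμ.2, densityLaw, ← hfst,
      Measure.map_map hdm measurable_fst]
    rfl
  have hρ : P ⊗ₘ ρ.condKernel = ρ := by
    conv_lhs => rw [← hρfst]
    exact ρ.disintegrate ρ.condKernel
  have h1 : ρ.condKernel.map Prod.fst =ᵐ[P] μs := by
    refine Kernel.ae_eq_of_compProd_eq ?_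
    rw [Measure.compProd_map measurable_fst, hρ, hμs.compProd_eq hμ, ← hfst,
      Measure.map_map (measurable_id.prodMap measurable_fst) hm,
      Measure.map_map (by fun_prop) measurable_fst]
    rfl
  have h2 : ρ.condKernel.map Prod.snd =ᵐ[P] νs := by
    refine Kernel.ae_eq_of_compProd_eq ?_
    rw [Measure.compProd_map measurable_snd, hρ, hνs.compProd_eq hν, ← hsnd,
      Measure.map_map (measurable_id.prodMap measurable_snd) hm,
      Measure.map_map (by fun_prop) measurable_snd]
    refine Measure.map_congr ?_
    -- `ρ` records the density at `x`; it can be replaced by the density at `y`.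
    filter_upwards [ae_density_eq_of_mem_kernels hμ hν hκ] with p hp
    simp [hp]
  have hcost : ∫⁻ p, c p.1 p.2 ∂π = ∫⁻ z, ∫⁻ p, c p.1 p.2 ∂(ρ.condKernel z) ∂P := by
    have hcm : Measurable fun w : (Fin d → ℝ) × ℝ × ℝ => c w.2.1 w.2.2 :=
      hc.measurable.comp measurable_snd
    rw [← Measure.lintegral_compProd hcm, hρ, lintegral_map hcm hm]
  rw [hcost]
  refine lintegral_mono_ae ?_
  filter_upwards [h1, h2] with z hz1 hz2
  rw [← hz1, ← hz2, Kernel.map_apply _ measurable_fst, Kernel.map_apply _ measurable_snd]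
  exact hsub.lintegral_quantile_le hc (ρ.condKernel z)

lemma exists_mem_plans_lintegral_eq (hμ : μ ∈ equivClass ℝ P) (hν : ν ∈ equivClass ℝ P)
    (hμs : IsSlicing μ μs) (hνs : IsSlicing ν νs)
    (hc : Measurable (fun p : ℝ × ℝ => c p.1 p.2)) :
    ∃ π ∈ plans μ ν, ∫⁻ p, c p.1 p.2 ∂π =
      ∫⁻ z, (∫⁻ t in Set.Ioo (0 : ℝ) 1, c (quantile (μs z) t) (quantile (νs z) t)) ∂P := by
  have := isProbabilityMeasure_avg hμ
  have := hμs.isMarkov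
  have := hνs.isMarkov
  set lam : Measure ℝ := volume.restrict (Set.Ioo (0 : ℝ) 1)
  have : IsProbabilityMeasure lam := ⟨by simp [lam]⟩
  have hqm := measurable_kernelQuantile μs
  have hqn := measurable_kernelQuantile νs
  have hΦ := hqm.prodMk hqn
  -- Both quantile functions share the pair of slice and level, so the plan is comonotone on each
  -- slice.
  let π := (P.prod lam).map fun w => (kernelQuantile μs w, kernelQuantile νs w)
  have : IsProbabilityMeasure π := Measure.isProbabilityMeasure_map hΦ.aemeasurable
  have hlaw {ξ : Fin d → Measure ℝ} {ξs : Kernel (Fin d → ℝ) ℝ} (hξ : ξ ∈ equivClass ℝ P)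
      (hξs : IsSlicing ξ ξs) : (P.prod lam).map (kernelQuantile ξs) = avg ξ ∧
      ∀ᵐ w ∂(P.prod lam), density ξ (kernelQuantile ξs w) = w.1 := by
    have := hξs.isMarkov
    have hd := measurable_density ξ
    have hq := measurable_kernelQuantile ξs
    have h := (map_prod_kernelQuantile P ξs).trans (hξs.compProd_eq hξ)
    constructor
    · have h' := congrArg (Measure.map Prod.snd) h
      rw [Measure.map_map measurable_snd (measurable_fst.prodMk hq),
        Measure.map_map measurable_snd (by fun_prop)] at h'
      exact h'.trans Measure.map_id
    · have hs : MeasurableSet {v : (Fin d → ℝ) × ℝ | density ξ v.2 = v.1} :=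
        measurableSet_eq_fun (hd.comp measurable_snd) measurable_fst
      have h' : ∀ᵐ v ∂((avg ξ).map fun x => (density ξ x, x)), density ξ v.2 = v.1 :=
        (ae_map_iff (hd.prodMk measurable_id).aemeasurable hs).2 (ae_of_all _ fun _ => rfl)
      rw [← h] at h'
      exact (ae_map_iff (measurable_fst.prodMk hq).aemeasurable hs).1 h'
  have hπfst : π.fst = avg μ := by
    rw [Measure.fst, Measure.map_map measurable_fst hΦ, ← (hlaw hμ hμs).1]
    rfl
  have hπ : avg μ ⊗ₘ π.condKernel = π := by
    conv_lhs => rw [← hπfst]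
    exact π.disintegrate π.condKernel
  refine ⟨π, ⟨π.condKernel, ⟨inferInstance, fun j => ?_⟩, hπ.symm⟩, ?_⟩
  · refine Measure.le_iff.2 fun s hs => le_of_eq ?_
    have hg : Measurable (s.indicator (1 : ℝ → ℝ≥0∞)) := measurable_one.indicator hs
    rw [← lintegral_indicator_one hs, ← lintegral_indicator_one hs,
      ← lintegral_compProd_density_mul hμ π.condKernel j hg, hπ,
      ← lintegral_density_mul hν j hg, ← (hlaw hν hνs).1,
      lintegral_map (by fun_prop) hqn, lintegral_map (by fun_prop) hΦ]
    refine lintegral_congr_ae ?_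
    -- Both densities equal the slice label, so reweighting by either one gives the same result.
    filter_upwards [(hlaw hμ hμs).2, (hlaw hν hνs).2] with w h1 h2
    simp only [h1, h2]
  · have hcΦ : Measurable fun w => c (kernelQuantile μs w) (kernelQuantile νs w) := hc.comp hΦ
    rw [lintegral_map hc hΦ, lintegral_prod _ hcΦ.aemeasurable]
    refine lintegral_congr fun z => setLIntegral_congr_fun measurableSet_Ioo fun t ht => ?_
    simp only [kernelQuantile_of_mem _ ht]

end Cost

end SOT

theorem corollary4p5 {d : ℕ} (P : Measure (Fin d → ℝ)) [IsProbabilityMeasure P]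
    (μ ν : Fin d → Measure ℝ)
    (hμ : μ ∈ SOT.equivClass ℝ P) (hν : ν ∈ SOT.equivClass ℝ P)
    (μs νs : Kernel (Fin d → ℝ) ℝ)
    (hμs : SOT.IsSlicing μ μs) (hνs : SOT.IsSlicing ν νs)
    (c : ℝ → ℝ → ℝ≥0∞)
    (hc : Continuous (fun p : ℝ × ℝ => c p.1 p.2))
    (hsub : SOT.Submodular c) :
    SOT.minCost c μ ν =
      ∫⁻ z, (∫⁻ t in Set.Ioo (0 : ℝ) 1,
        c (SOT.quantile (μs z) t) (SOT.quantile (νs z) t)) ∂P := by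
  refine le_antisymm ?_ (le_iInf₂ fun π hπ => ?_)
  · obtain ⟨π, hπ, h⟩ := SOT.exists_mem_plans_lintegral_eq hμ hν hμs hνs hc.measurable
    exact h ▸ iInf₂_le π hπ
  · obtain ⟨κ, hκ, rfl⟩ := hπ
    exact SOT.le_lintegral_of_mem_kernels hμ hν hμs hνs hc hsub hκ
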